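/- Let $M\ge 2$ be the local dimension of each particle. There are a number $r$ of feature maps and a constant $c>0$, depending only on $M$, such that for every kernel size $K\ge 2$ there is a constant $C$ for which the following holds for every $H\ge 1$, with $N=H^2$ particles on the sites of an $H\times H$ square lattice. An overlapping convolutional arithmetic circuit of depth $L$ (kernels of size $K\times K$, stride $1$) maps vectors $x^{(0)}_p\in\mathbb R^M$, one for each site $p$, to $x^{(l)}_p\in\mathbb R^r$, $l=1,\dots,L$, by $$\big(x^{(l)}_p\big)_i=\prod_{k}\big(W^{(k,l)}x^{(l-1)}_{p+k}\big)_i ,$$ where $k$ runs over the $K^2$ positions of the centred kernel window $\{-\lfloor\frac{K-1}2\rfloor,\dots,\lfloor\frac K2\rfloor\}^2$ for which $p+k$ lies in the lattice (positions outside contribute no factor), followed by global product pooling $y=\prod_p\langle w,x^{(L)}_p\rangle$. The real weights $W^{(k,l)}$ and $w$ are shared by all sites; their entries are the parameters, so that for fixed $r$ and $M$ their number is proportional to $LK^2$ up to constant factors. The circuit represents the $N$-particle state whose amplitude at $(s_p)_p\in\{1,\dots,M\}^N$ is the output $y$ on the standard basis vectors $x^{(0)}_p=\hat e^{(s_p)}$.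 1. For every depth $L$ with $LK>\sqrt N$ the weights can be chosen so that the represented state obeys a volume law: for every $\alpha\times\alpha$ square $A$ of the lattice with complement $B$ and $|A|\le|B|$, the entanglement entropy (von Neumann entropy of the reduced density matrix on $A$ of the normalized state) with respect to $(A,B)$ is at least $c\,\alpha^2$. 2. There is a depth $L$ with $LK>\sqrt N$ for which the number of parameters is at most $C\sqrt N$. Thus the number of overlapping-convolutional network parameters required for modeling volume-law entanglement scaling in a 2D system of $N$ particles scales like $O(\sqrt N)$. -/

import Mathlib

open scoped Matrix

namespace OverlapCAC

/-- The sites of an `H × H` square lattice. -/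
abbrev Site (H : ℕ) : Type := Fin H × Fin H

/-- One overlapping convolutional layer (stride `1`, kernel size `K × K`) of a convolutional
arithmetic circuit. The window of the output site `p` consists of the sites
`p + k - ((K - 1) / 2, (K - 1) / 2)`, where `k` runs over the kernel positions, so that it is
centred at `p`. The output vector at `p` is the entrywise product over the window of the vectors
`W k *ᵥ x q`. Kernel positions that fall outside the lattice contribute no factor, so that an
output is produced at the edge sites as well. -/
def convLayer {K H rin rout : ℕ} (W : Fin K × Fin K → Matrix (Fin rout) (Fin rin) ℝ)
    (x : Site H → Fin rin → ℝ) : Site H → Fin rout → ℝ :=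
  fun p c => ∏ k : Fin K × Fin K,
    ∏ q ∈ (Finset.univ : Finset (Site H)).filter (fun q =>
        q.1.val + (K - 1) / 2 = p.1.val + k.1.val ∧ q.2.val + (K - 1) / 2 = p.2.val + k.2.val),
      (W k *ᵥ x q) c

/-- The number of feature maps after layer `l`: the input has `M` of them, the output of the
`(l + 1)`-st layer has `r l`. -/
def width (M : ℕ) (r : ℕ → ℕ) : ℕ → ℕ
  | 0 => M
  | l + 1 => r l

/-- The weights of an overlapping convolutional arithmetic circuit of depth `L` with kernel size
`K × K`: one matrix for each layer and each kernel position, shared by all sites, and the vector of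
the linear map in the global pooling layer, which is shared by all sites, too. -/
structure Weights (M K L : ℕ) (r : ℕ → ℕ) where
  conv : ∀ l : Fin L, Fin K × Fin K →
    Matrix (Fin (width M r (l.val + 1))) (Fin (width M r l.val)) ℝ
  pool : Fin (width M r L) → ℝ

/-- The number of real parameters in `Weights M K L r`. -/
def numParams (M K L : ℕ) (r : ℕ → ℕ) : ℕ :=
  (∑ l : Fin L, K ^ 2 * (width M r (l.val + 1) * width M r l.val)) + width M r L

/-- The activations after the first `l` convolutional layers, on the input `x`. -/
def activation {M K L H : ℕ} {r : ℕ → ℕ} (θ : Weights M K L r) (x : Site H → Fin M → ℝ) :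
    (l : ℕ) → l ≤ L → Site H → Fin (width M r l) → ℝ
  | 0, _ => x
  | l + 1, h => convLayer (θ.conv ⟨l, h⟩) (activation θ x l (Nat.le_of_succ_le h))

/-- The scalar output of the network: global product pooling after the `L` layers. -/
def output {M K L H : ℕ} {r : ℕ → ℕ} (θ : Weights M K L r) (x : Site H → Fin M → ℝ) : ℝ :=
  ∏ p : Site H, θ.pool ⬝ᵥ activation θ x L le_rfl p

/-- The (unnormalized) state represented by the network: the amplitude of the configuration `s` is
the output of the network on the standard basis vectors `e_{s p}`, one for each site `p`. -/
def state {M K L : ℕ} {r : ℕ → ℕ} (θ : Weights M K L r) (H : ℕ) : (Site H → Fin M) → ℂ :=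
  fun s => ((output θ (fun p => Pi.single (s p) (1 : ℝ)) : ℝ) : ℂ)

section Entanglement

variable {Λ : Type*} [DecidableEq Λ] {M : ℕ}

/-- The matricization of a state with respect to the partition `(A, Aᶜ)` of its sites. -/
def coeffMatrix (ψ : (Λ → Fin M) → ℂ) (A : Finset Λ) :
    Matrix ({p : Λ // p ∈ A} → Fin M) ({p : Λ // p ∉ A} → Fin M) ℂ :=
  Matrix.of fun a b => ψ fun p => if h : p ∈ A then a ⟨p, h⟩ else b ⟨p, h⟩

variable [Fintype Λ]

/-- The reduced density matrix on `A` of the normalized state `ψ / ‖ψ‖` (zero if `ψ = 0`). -/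
noncomputable def reducedDensity (ψ : (Λ → Fin M) → ℂ) (A : Finset Λ) :
    Matrix ({p : Λ // p ∈ A} → Fin M) ({p : Λ // p ∈ A} → Fin M) ℂ :=
  (∑ s, ‖ψ s‖ ^ 2)⁻¹ • (coeffMatrix ψ A * (coeffMatrix ψ A)ᴴ)

theorem reducedDensity_isHermitian (ψ : (Λ → Fin M) → ℂ) (A : Finset Λ) :
    (reducedDensity ψ A).IsHermitian := by
  unfold reducedDensity
  rw [Matrix.IsHermitian, Matrix.conjTranspose_smul, star_trivial,
    Matrix.conjTranspose_mul, Matrix.conjTranspose_conjTranspose]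

/-- The entanglement entropy of `ψ` with respect to `(A, Aᶜ)`: the von Neumann entropy
`- ∑ λ log λ` of the reduced density matrix on `A`, with eigenvalues `λ`. -/
noncomputable def entanglementEntropy (ψ : (Λ → Fin M) → ℂ) (A : Finset Λ) : ℝ :=
  ∑ i, Real.negMulLog ((reducedDensity_isHermitian ψ A).eigenvalues i)

end Entanglement

/-- The sites of the `α × α` square with corner `(a, b)`. -/
def block (H a b α : ℕ) : Finset (Site H) :=
  (Finset.univ : Finset (Site H)).filter fun p =>
    (a ≤ p.1.val ∧ p.1.val < a + α) ∧ (b ≤ p.2.val ∧ p.2.val < b + α)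

/-- Volume-law entanglement with constant `c`: for every `α × α` square `A` of the lattice that
holds at most half of the sites, the entanglement entropy with respect to `(A, Aᶜ)` is at least
`c * α ^ 2`. -/
def VolumeLaw {M H : ℕ} (c : ℝ) (ψ : (Site H → Fin M) → ℂ) : Prop :=
  ∀ a b α : ℕ, a + α ≤ H → b + α ≤ H →
    (block H a b α).card ≤ ((block H a b α)ᶜ).card →
      c * (α : ℝ) ^ 2 ≤ entanglementEntropy ψ (block H a b α)

end OverlapCAC

/-!
The network is made to represent a graph state on two of the `M` local levels. With
`d = max 1 (H / 3)`, the sites `p` and `p + (d, 0)` are joined by an edge, the amplitude vanishes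
unless all `s p` lie in `{0, 1}`, and otherwise it is the product of `-1` over the edges with `1` at
both ends.

*Representation.* A circuit with five feature maps can keep, at each site `p`, the constant `1`, the
indicators of `s p = 0` and of `s p = 1`, the sign `(-1) ^ s` of the site `p + (D, 0)`, and the
product of the last two. As `D` can be increased by any amount up to `K / 2` per layer, and a factor
from outside of the lattice is `1` by the definition of a layer, depth `L` reaches every
`d ≤ L * (K / 2)` (`readout_activation`, `state_shiftWeights`). The hypothesis `H < L * K` gives
`H / 3 ≤ L * (K / 2)`.

*Entropy.* All nonzero amplitudes of a graph state have modulus `1`. Let `A'` be a set of sites of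
`A`, each with a partner outside of `A` whose only neighbour in `A` is that site. Flipping the
partner of `p` changes the sign of `ψ (a, b) * ψ (a', b)` if `a` and `a'` differ at `p`, so rows of
the coefficient matrix that differ on `A'` are orthogonal (`sum_mul_graphState_eq_zero`). Hence the
absolute row sums of the reduced density matrix, and by Gershgorin's theorem its eigenvalues, are at
most `2 ^ (-|A'|)`, and the entropy is at least `|A'| log 2` (`entanglementEntropy_graphState_ge`).

*Counting.* A square with at most half of the sites has side `α ≤ 3 H / 4`, so that the free margin
on its left or on its right is at least `H / 8`. The sites of `A` that are shifted by `d` into the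
wider margin form a box of `α` columns of length at least `α / 6`
(`volumeLaw_graphState_shiftEdge`).
-/

namespace OverlapCAC

/-! ### Entropy of a matrix with small row sums -/

/-- Every eigenvalue lies in a Gershgorin disc, and every such disc lies in the disc around `0`
whose radius is the absolute row sum. -/
theorem eigenvalues_le_of_row_sum_le {n : Type*} [Fintype n] [DecidableEq n]
    {ρ : Matrix n n ℂ} (hρ : ρ.IsHermitian) {t : ℝ} (h : ∀ a, ∑ b, ‖ρ a b‖ ≤ t) (i : n) :
    hρ.eigenvalues i ≤ t := by
  have hev : Module.End.HasEigenvalue (Matrix.toLin' ρ) (hρ.eigenvalues i : ℂ) := by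
    refine Module.End.hasEigenvalue_of_hasEigenvector
      (x := (hρ.eigenvectorBasis i).ofLp) ⟨?_, ?_⟩
    · rw [Module.End.mem_eigenspace_iff, Matrix.toLin'_apply, hρ.mulVec_eigenvectorBasis i]
      rfl
    · intro h0
      exact hρ.eigenvectorBasis.orthonormal.ne_zero i (by ext j; exact congrFun h0 j)
  obtain ⟨k, hk⟩ := eigenvalue_mem_ball hev
  rw [mem_closedBall_iff_norm] at hk
  calc hρ.eigenvalues i ≤ ‖(hρ.eigenvalues i : ℂ)‖ := by
        rw [Complex.norm_real]; exact le_abs_self _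
    _ ≤ ‖ρ k k‖ + ‖(hρ.eigenvalues i : ℂ) - ρ k k‖ := by
        simpa using norm_add_le (ρ k k) ((hρ.eigenvalues i : ℂ) - ρ k k)
    _ ≤ ‖ρ k k‖ + ∑ j ∈ Finset.univ.erase k, ‖ρ k j‖ := by gcongr
    _ = ∑ j, ‖ρ k j‖ := Finset.add_sum_erase _ (fun j => ‖ρ k j‖) (Finset.mem_univ k)
    _ ≤ t := h k

section

variable {Λ : Type*} [DecidableEq Λ] {M : ℕ}

/-- The configuration that is `a` on `A` and `b` on the complement of `A`. -/
def glue (A : Finset Λ) (a : {p : Λ // p ∈ A} → Fin M) (b : {p : Λ // p ∉ A} → Fin M) :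
    Λ → Fin M :=
  fun p => if h : p ∈ A then a ⟨p, h⟩ else b ⟨p, h⟩

theorem glue_of_mem {A : Finset Λ} (a : {p : Λ // p ∈ A} → Fin M)
    (b : {p : Λ // p ∉ A} → Fin M) {p : Λ} (h : p ∈ A) : glue A a b p = a ⟨p, h⟩ := dif_pos h

theorem glue_of_notMem {A : Finset Λ} (a : {p : Λ // p ∈ A} → Fin M)
    (b : {p : Λ // p ∉ A} → Fin M) {p : Λ} (h : p ∉ A) : glue A a b p = b ⟨p, h⟩ := dif_neg h

theorem glue_update {A : Finset Λ} (a : {p : Λ // p ∈ A} → Fin M)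
    (b : {p : Λ // p ∉ A} → Fin M) (q : {p : Λ // p ∉ A}) (x : Fin M) :
    glue A a (Function.update b q x) = Function.update (glue A a b) q x := by
  funext p
  by_cases hp : p ∈ A
  · have : p ≠ q := fun h => q.2 (h ▸ hp)
    rw [Function.update_of_ne this, glue_of_mem _ _ hp, glue_of_mem _ _ hp]
  · rw [glue_of_notMem _ _ hp]
    by_cases hq : p = q
    · subst hq; simp
    · rw [Function.update_of_ne hq, glue_of_notMem _ _ hp,
        Function.update_of_ne (fun h => hq (congrArg Subtype.val h))]

variable [Fintype Λ]

theorem sum_glue {N : Type*} [AddCommMonoid N] (A : Finset Λ) (f : (Λ → Fin M) → N) :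
    ∑ s, f s = ∑ a, ∑ b, f (glue A a b) := by
  rw [← Fintype.sum_prod_type',
    ← (Equiv.piEquivPiSubtypeProd (fun p => p ∈ A) (fun _ => Fin M)).symm.sum_comp]
  rfl

theorem reducedDensity_trace {ψ : (Λ → Fin M) → ℂ} (hψ : ∑ s, ‖ψ s‖ ^ 2 ≠ 0) (A : Finset Λ) :
    (reducedDensity ψ A).trace = 1 := by
  have h : (coeffMatrix ψ A * (coeffMatrix ψ A)ᴴ).trace = ((∑ s, ‖ψ s‖ ^ 2 : ℝ) : ℂ) := by
    rw [sum_glue A]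
    simp only [Matrix.trace, Matrix.diag, Matrix.mul_apply, Matrix.conjTranspose_apply]
    push_cast
    refine Finset.sum_congr rfl fun a _ => Finset.sum_congr rfl fun b _ => ?_
    exact Complex.mul_conj' _
  rw [reducedDensity, Matrix.trace_smul, h, Complex.real_smul, ← Complex.ofReal_mul,
    inv_mul_cancel₀ hψ, Complex.ofReal_one]

open scoped ComplexOrder in
theorem reducedDensity_posSemidef (ψ : (Λ → Fin M) → ℂ) (A : Finset Λ) :
    (reducedDensity ψ A).PosSemidef :=
  (Matrix.posSemidef_self_mul_conjTranspose _).smul (by positivity)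

/-- The von Neumann entropy is at least the min-entropy `-log λ_max`, with the largest eigenvalue
bounded by the absolute row sums. -/
theorem neg_log_le_entanglementEntropy {ψ : (Λ → Fin M) → ℂ} (hψ : ∑ s, ‖ψ s‖ ^ 2 ≠ 0)
    (A : Finset Λ) {t : ℝ} (h : ∀ a, ∑ b, ‖reducedDensity ψ A a b‖ ≤ t) :
    -Real.log t ≤ entanglementEntropy ψ A := by
  have hρ := reducedDensity_isHermitian ψ A
  have hsum : ∑ i, hρ.eigenvalues i = 1 := by
    have h1 := hρ.trace_eq_sum_eigenvalues
    rw [reducedDensity_trace hψ A] at h1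
    exact Complex.ofReal_injective (by rw [Complex.ofReal_sum, Complex.ofReal_one]; exact h1.symm)
  calc -Real.log t = ∑ i, hρ.eigenvalues i * -Real.log t := by
        rw [← Finset.sum_mul, hsum, one_mul]
    _ ≤ ∑ i, Real.negMulLog (hρ.eigenvalues i) := by
        refine Finset.sum_le_sum fun i _ => ?_
        rw [Real.negMulLog, neg_mul, mul_neg]
        rcases ((reducedDensity_posSemidef ψ A).eigenvalues_nonneg i).eq_or_lt with h0 | h0
        · rw [show hρ.eigenvalues i = 0 from h0.symm]; simp
        · exact neg_le_neg (mul_le_mul_of_nonneg_left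
            (Real.log_le_log h0 (eigenvalues_le_of_row_sum_le hρ h i)) h0.le)

end

/-! ### Convolution with two nontrivial kernel positions -/

/-- The directed edges `p → p + (d, 0)` that stay inside the lattice. -/
def shiftEdge (H d : ℕ) (p q : Site H) : Prop := q.1.val = p.1.val + d ∧ q.2 = p.2

instance (H d : ℕ) : DecidableRel (shiftEdge H d) := fun _ _ => instDecidableAnd

theorem shiftEdge_zero {H : ℕ} (p q : Site H) : shiftEdge H 0 p q ↔ q = p := by
  rw [shiftEdge, add_zero, ← Fin.ext_iff, Prod.ext_iff]

theorem prod_shiftEdge_add {H : ℕ} (d e : ℕ) (f : Site H → ℝ) (p : Site H) :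
    (∏ q, if shiftEdge H d p q then ∏ q', (if shiftEdge H e q q' then f q' else 1) else 1) =
      ∏ q', if shiftEdge H (e + d) p q' then f q' else 1 := by
  by_cases h : p.1.val + d < H
  · have hq : ∀ q, shiftEdge H d p q ↔ q = (⟨p.1.val + d, h⟩, p.2) := fun q => by
      simp [shiftEdge, Prod.ext_iff, Fin.ext_iff]
    simp only [hq, Finset.prod_ite_eq', Finset.mem_univ, if_true]
    refine Finset.prod_congr rfl fun q' _ => if_congr ?_ rfl rfl
    simp only [shiftEdge, add_assoc, add_comm d e]
  · rw [Finset.prod_eq_one, Finset.prod_eq_one]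
    · intro q _
      exact if_neg fun hq => by have := hq.1; have := q.1.2; omega
    · intro q _
      exact if_neg fun hq => by have := hq.1; have := q.1.2; omega

/-- The kernel position `k` is the one of displacement `(δ, 0)` from the centre of the window. -/
def IsDisp (K δ : ℕ) (k : Fin K × Fin K) : Prop :=
  k.1.val = (K - 1) / 2 + δ ∧ k.2.val = (K - 1) / 2

instance (K δ : ℕ) : DecidablePred (IsDisp K δ) := fun _ => instDecidableAnd

/-- A layer in which only the kernel position of displacement `(δ, 0)` is nontrivial reads off the
value at `p + (δ, 0)`, or `1` if that site is outside of the lattice. -/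
theorem prod_window_disp {K H : ℕ} {δ : ℕ} (hK : 0 < K) (hδ : δ ≤ K / 2) (f : Site H → ℝ)
    (p : Site H) :
    (∏ k : Fin K × Fin K, ∏ q ∈ (Finset.univ : Finset (Site H)).filter (fun q =>
        q.1.val + (K - 1) / 2 = p.1.val + k.1.val ∧ q.2.val + (K - 1) / 2 = p.2.val + k.2.val),
      if IsDisp K δ k then f q else 1) = ∏ q, if shiftEdge H δ p q then f q else 1 := by
  have hk : ∀ k, IsDisp K δ k ↔
      k = (⟨(K - 1) / 2 + δ, by omega⟩, ⟨(K - 1) / 2, by omega⟩) := fun k => by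
    simp [IsDisp, Prod.ext_iff, Fin.ext_iff]
  simp only [hk, Finset.prod_filter]
  rw [Finset.prod_comm]
  refine Finset.prod_congr rfl fun q _ => ?_
  rw [Finset.prod_eq_single (⟨(K - 1) / 2 + δ, by omega⟩, ⟨(K - 1) / 2, by omega⟩)]
  · rw [if_pos rfl]
    refine if_congr ?_ rfl rfl
    simp only [shiftEdge, Fin.ext_iff]
    omega
  · intro k _ hk; simp [hk]
  · simp

/-- The sign of a level: `-1` on the level `1`, and `1` on all others. -/
def signAt {M : ℕ} (x : Fin M) : ℝ := if x.val = 1 then -1 else 1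

/-- The five features of a single site as linear functionals of its one-hot vector; these are the
values of `feature` at the shift `0`. -/
def inputFeature (M : ℕ) : Matrix (Fin 5) (Fin M) ℝ :=
  Matrix.of fun i x => ![1, if x.val = 0 then 1 else 0, if x.val = 1 then 1 else 0, signAt x,
    (if x.val = 1 then 1 else 0) * signAt x] i

/-- The features at `p` after a total shift `D`: the constant `1`, the indicators of the levels `0`
and `1` at `p`, the sign at `p + (D, 0)` (`1` if outside of the lattice), and the product of the last
two. -/
def feature {M H : ℕ} (s : Site H → Fin M) (D : ℕ) (p : Site H) : Fin 5 → ℝ :=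
  ![1, if (s p).val = 0 then 1 else 0, if (s p).val = 1 then 1 else 0,
    ∏ q, if shiftEdge H D p q then signAt (s q) else 1,
    (if (s p).val = 1 then 1 else 0) * ∏ q, if shiftEdge H D p q then signAt (s q) else 1]

/-- The feature of the previous layer that enters the product for a given feature through the
kernel position `k`, in a layer that shifts by `δ`. The feature `0` stands for a trivial factor. For
`δ = 0` the two factors of the last feature would come from the same kernel position, so that the
product, which is already present, is copied instead. -/
def select (K δ : ℕ) (k : Fin K × Fin K) : Fin 5 → Fin 5 :=
  ![0, if IsDisp K 0 k then 1 else 0, if IsDisp K 0 k then 2 else 0,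
    if IsDisp K δ k then 3 else 0,
    if IsDisp K 0 k then if δ = 0 then 4 else 2 else if IsDisp K δ k then 3 else 0]

/-- The layer with the selection `select K δ` turns the features for the shift `D` into those for the
shift `D + δ`. -/
theorem prod_window_feature {M K H : ℕ} {δ : ℕ} (hK : 0 < K) (hδ : δ ≤ K / 2)
    (s : Site H → Fin M) (D : ℕ) (p : Site H) (c : Fin 5) :
    (∏ k : Fin K × Fin K, ∏ q ∈ (Finset.univ : Finset (Site H)).filter (fun q =>
        q.1.val + (K - 1) / 2 = p.1.val + k.1.val ∧ q.2.val + (K - 1) / 2 = p.2.val + k.2.val),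
      feature s D q (select K δ k c)) = feature s (D + δ) p c := by
  have h0 := fun f => prod_window_disp (K := K) (H := H) (δ := 0) hK (Nat.zero_le _) f p
  simp only [shiftEdge_zero, Finset.prod_ite_eq', Finset.mem_univ, if_true] at h0
  have hδ' := fun f => prod_window_disp (K := K) (H := H) hK hδ f p
  have ite_feat : ∀ (P : Prop) [Decidable P] (i j : Fin 5) (q : Site H),
      feature s D q (if P then i else j) = if P then feature s D q i else feature s D q j :=
    fun P _ i j q => apply_ite _ _ _ _
  have f0 : ∀ q, feature s D q 0 = 1 := fun q => rfl
  have f3 : ∀ q, feature s D q 3 = ∏ q', if shiftEdge H D q q' then signAt (s q') else 1 :=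
    fun q => rfl
  have e1 : ∀ k, select K δ k 1 = if IsDisp K 0 k then 1 else 0 := fun _ => rfl
  have e2 : ∀ k, select K δ k 2 = if IsDisp K 0 k then 2 else 0 := fun _ => rfl
  have e3 : ∀ k, select K δ k 3 = if IsDisp K δ k then 3 else 0 := fun _ => rfl
  have e4 : ∀ k, select K δ k 4 = if IsDisp K 0 k then if δ = 0 then 4 else 2
    else if IsDisp K δ k then 3 else 0 := fun _ => rfl
  fin_cases c
  · exact Finset.prod_eq_one fun k _ => Finset.prod_eq_one fun q _ => rfl
  · simp only [Fin.mk_one, e1, ite_feat, f0, h0]; rfl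
  · simp only [Fin.reduceFinMk, e2, ite_feat, f0, h0]; rfl
  · simp only [Fin.reduceFinMk, e3, ite_feat, f0, hδ', f3, prod_shiftEdge_add]; rfl
  · change (∏ k, ∏ q ∈ _, feature s D q (select K δ k 4)) = feature s (D + δ) p 4
    by_cases hd : δ = 0
    · subst hd
      have e : ∀ k, select K 0 k 4 = if IsDisp K 0 k then 4 else 0 := fun k => by
        rw [e4, if_pos rfl]; split_ifs <;> rfl
      simp only [e, ite_feat, f0, h0]; rfl
    · have : ∀ (k : Fin K × Fin K) (q : Site H),
          feature s D q (select K δ k 4) =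
          (if IsDisp K 0 k then feature s D q 2 else 1) *
            (if IsDisp K δ k then feature s D q 3 else 1) := fun k q => by
        rw [e4, if_neg hd, ite_feat, ite_feat, f0]
        by_cases h1 : IsDisp K 0 k
        · have h2 : ¬ IsDisp K δ k := fun h2 => hd (by have := h1.1; have := h2.1; omega)
          rw [if_pos h1, if_pos h1, if_neg h2, mul_one]
        · rw [if_neg h1, if_neg h1, one_mul]
      simp only [this, Finset.prod_mul_distrib, h0, hδ', f3, prod_shiftEdge_add]; rfl

/-- The linear map that extracts the five features from the activations of layer `l`: they are
functionals of the input for `l = 0`, and the activations themselves afterwards. -/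
def readout (M : ℕ) : (l : ℕ) → Matrix (Fin 5) (Fin (width M (fun _ => 5) l)) ℝ
  | 0 => inputFeature M
  | _ + 1 => (1 : Matrix (Fin 5) (Fin 5) ℝ)

/-- The total shift after `l` layers: each layer shifts by `K / 2`, until `d` is reached. -/
def offset (K d l : ℕ) : ℕ := min d (l * (K / 2))

/-- The weights of a network for the shift by `d`. The pooling vector adds the indicator of the level
`0` and the product of the indicator of the level `1` with the shifted sign. -/
def shiftWeights (M K L d : ℕ) : Weights M K L (fun _ => 5) where
  conv l k := (readout M l.val).submatrix
    (select K (offset K d (l.val + 1) - offset K d l.val) k) id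
  pool j := readout M L 1 j + readout M L 4 j

theorem readout_activation {M K L H : ℕ} (hK : 0 < K) (d : ℕ) (s : Site H → Fin M) :
    ∀ (l : ℕ) (hl : l ≤ L) (p : Site H),
      readout M l *ᵥ activation (shiftWeights M K L d) (fun p => Pi.single (s p) (1 : ℝ)) l hl p =
        feature s (offset K d l) p
  | 0, _, p => by
    funext i
    have h0 : offset K d 0 = 0 := by simp [offset]
    rw [h0]
    change (inputFeature M *ᵥ Pi.single (s p) (1 : ℝ)) i = _
    rw [Matrix.mulVec_single_one]
    simp only [feature, shiftEdge_zero, Finset.prod_ite_eq', Finset.mem_univ, if_true]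
    rfl
  | l + 1, hl, p => by
    have ih := readout_activation hK d s l (Nat.le_of_succ_le hl)
    have hmono : offset K d l ≤ offset K d (l + 1) :=
      min_le_min_left _ (Nat.mul_le_mul_right _ (Nat.le_succ l))
    have hstep : offset K d (l + 1) - offset K d l ≤ K / 2 := by
      unfold offset; rw [Nat.succ_mul]; omega
    change (1 : Matrix (Fin 5) (Fin 5) ℝ) *ᵥ convLayer _ _ p = _
    rw [Matrix.one_mulVec]
    funext c
    have h := prod_window_feature hK hstep s (offset K d l) p c
    rw [Nat.add_sub_cancel' hmono] at h
    rw [← h]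
    refine Finset.prod_congr rfl fun k _ => Finset.prod_congr rfl fun q _ => ?_
    exact congrFun (ih q) _

theorem output_shiftWeights {M K L H : ℕ} (hK : 0 < K) {d : ℕ} (hd : d ≤ L * (K / 2))
    (s : Site H → Fin M) :
    output (shiftWeights M K L d) (fun p => Pi.single (s p) (1 : ℝ)) =
      ∏ p, ((if (s p).val = 0 then 1 else 0) + (if (s p).val = 1 then 1 else 0) *
        ∏ q, if shiftEdge H d p q then signAt (s q) else 1) := by
  refine Finset.prod_congr rfl fun p _ => ?_
  have h := readout_activation (L := L) hK d s L le_rfl p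
  rw [show offset K d L = d from min_eq_left hd] at h
  have h1 := congrFun h 1
  have h4 := congrFun h 4
  calc _ = (readout M L *ᵥ activation (shiftWeights M K L d)
            (fun p => Pi.single (s p) (1 : ℝ)) L le_rfl p) 1 +
          (readout M L *ᵥ activation (shiftWeights M K L d)
            (fun p => Pi.single (s p) (1 : ℝ)) L le_rfl p) 4 := add_dotProduct _ _ _
    _ = _ := by rw [h1, h4]; rfl

/-! ### Graph states on two levels -/

/-- The indicator of the two levels `0` and `1`. -/
def lowLevel {M : ℕ} (x : Fin M) : ℝ := if x.val < 2 then 1 else 0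

/-- The sign `(-1) ^ (x * y)` of an edge, extended by `1` to the levels above `1`. -/
def edgeSign {M : ℕ} (x y : Fin M) : ℝ := if x.val = 1 ∧ y.val = 1 then -1 else 1

theorem sum_lowLevel_sq {M : ℕ} (hM : 2 ≤ M) : ∑ x : Fin M, lowLevel x ^ 2 = 2 := by
  have h : ∀ x : Fin M, lowLevel x ^ 2 = if x.val < 2 then (1 : ℝ) else 0 := fun x => by
    unfold lowLevel; split_ifs <;> simp
  simp only [h]
  rw [Finset.sum_boole, Fin.card_filter_val_lt, min_eq_right hM, Nat.cast_ofNat]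

/-- The exchange of the levels `0` and `1`. -/
def levelFlip {M : ℕ} (hM : 2 ≤ M) : Equiv.Perm (Fin M) :=
  Equiv.swap ⟨0, by omega⟩ ⟨1, by omega⟩

theorem levelFlip_cases {M : ℕ} (hM : 2 ≤ M) (x : Fin M) :
    (x.val = 0 ∧ (levelFlip hM x).val = 1) ∨ (x.val = 1 ∧ (levelFlip hM x).val = 0) ∨
      (2 ≤ x.val ∧ levelFlip hM x = x) := by
  by_cases h0 : x.val = 0
  · left
    refine ⟨h0, ?_⟩
    rw [show x = ⟨0, by omega⟩ from Fin.ext h0, levelFlip, Equiv.swap_apply_left]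
  · by_cases h1 : x.val = 1
    · right; left
      refine ⟨h1, ?_⟩
      rw [show x = ⟨1, by omega⟩ from Fin.ext h1, levelFlip, Equiv.swap_apply_right]
    · right; right
      refine ⟨by omega, Equiv.swap_apply_of_ne_of_ne ?_ ?_⟩ <;> simp [Fin.ext_iff, h0, h1]

theorem lowLevel_flip {M : ℕ} (hM : 2 ≤ M) (x : Fin M) : lowLevel (levelFlip hM x) = lowLevel x := by
  unfold lowLevel
  refine if_congr ?_ rfl rfl
  rcases levelFlip_cases hM x with h | h | h
  · omega
  · omega
  · rw [h.2]

theorem edgeSign_flip_left {M : ℕ} (hM : 2 ≤ M) {x : Fin M} (hx : x.val < 2) (y : Fin M) :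
    edgeSign (levelFlip hM x) y = edgeSign x y * signAt y := by
  rcases levelFlip_cases hM x with h | h | h
  · simp [edgeSign, signAt, h]
  · simp [edgeSign, signAt, h]; split_ifs <;> simp
  · omega

theorem edgeSign_flip_right {M : ℕ} (hM : 2 ≤ M) (x : Fin M) {y : Fin M} (hy : y.val < 2) :
    edgeSign x (levelFlip hM y) = edgeSign x y * signAt x := by
  rcases levelFlip_cases hM y with h | h | h
  · simp [edgeSign, signAt, h]
  · simp [edgeSign, signAt, h]; split_ifs <;> simp
  · omega

section

variable {Λ : Type*} [Fintype Λ] {M : ℕ}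

/-- The amplitudes of the (unnormalized) graph state of the edges `E`, on the levels `0` and `1` of
each site. Edges are directed, so that each is counted once if `E` is asymmetric. -/
def graphState (E : Λ → Λ → Prop) [DecidableRel E] (s : Λ → Fin M) : ℝ :=
  (∏ p, lowLevel (s p)) * ∏ p, ∏ q, if E p q then edgeSign (s p) (s q) else 1

variable (E : Λ → Λ → Prop) [DecidableRel E]

theorem abs_graphState (s : Λ → Fin M) : |graphState E s| = ∏ p, lowLevel (s p) := by
  have h : ∀ x y : Fin M, |edgeSign x y| = 1 := fun x y => by
    unfold edgeSign; split_ifs <;> simp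
  have h' : ∀ x : Fin M, |lowLevel x| = lowLevel x := fun x => by
    unfold lowLevel; split_ifs <;> simp
  rw [graphState, abs_mul, Finset.abs_prod, Finset.abs_prod]
  simp only [h', Finset.abs_prod]
  rw [Finset.prod_eq_one (f := fun p => ∏ q, _), mul_one]
  intro p _
  refine Finset.prod_eq_one fun q _ => ?_
  split_ifs <;> simp [h]

variable [DecidableEq Λ]

/-- A flip of the site `q` multiplies the amplitude by the signs of the neighbours of `q`. -/
theorem graphState_update_flip (hM : 2 ≤ M) {q : Λ} (hq : ¬ E q q) (s : Λ → Fin M) :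
    graphState E (Function.update s q (levelFlip hM (s q))) =
      graphState E s * ∏ p, ((if E p q then signAt (s p) else 1) *
        if E q p then signAt (s p) else 1) := by
  have hlow : ∏ p, lowLevel (Function.update s q (levelFlip hM (s q)) p) = ∏ p, lowLevel (s p) := by
    refine Finset.prod_congr rfl fun p _ => ?_
    by_cases hp : p = q
    · subst hp; rw [Function.update_self, lowLevel_flip]
    · rw [Function.update_of_ne hp]
  by_cases hs : (s q).val < 2
  swap
  -- Outside of the two levels at `q` both amplitudes vanish.
  · have h0 : ∏ p, lowLevel (s p) = 0 :=
      Finset.prod_eq_zero (Finset.mem_univ q) (if_neg hs)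
    rw [graphState, graphState, hlow, h0]; simp
  have hedge : ∀ p p', (if E p p' then edgeSign (Function.update s q (levelFlip hM (s q)) p)
        (Function.update s q (levelFlip hM (s q)) p') else 1) =
      (if E p p' then edgeSign (s p) (s p') else 1) *
        ((if p' = q then (if E p q then signAt (s p) else 1) else 1) *
          if p = q then (if E q p' then signAt (s p') else 1) else 1) := fun p p' => by
    by_cases hp : p = q
    · subst hp
      by_cases hp' : p' = p
      · subst hp'; simp [hq]
      · rw [Function.update_self, Function.update_of_ne hp', edgeSign_flip_left hM hs]
        simp only [hp', if_false, if_true, one_mul]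
        split_ifs <;> simp
    · rw [Function.update_of_ne hp]
      by_cases hp' : p' = q
      · subst hp'
        rw [Function.update_self, edgeSign_flip_right hM _ hs]
        simp only [hp, if_false, if_true, mul_one]
        split_ifs <;> simp
      · rw [Function.update_of_ne hp']; simp [hp, hp']
  rw [graphState, graphState, hlow, mul_assoc]
  congr 1
  simp only [hedge, Finset.prod_mul_distrib, Finset.prod_ite_eq', Finset.mem_univ, if_true]
  congr 2
  rw [Finset.prod_comm]
  simp only [Finset.prod_ite_eq', Finset.mem_univ, if_true]

theorem sum_prod_lowLevel_sq (hM : 2 ≤ M) :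
    ∑ s : Λ → Fin M, (∏ p, lowLevel (s p)) ^ 2 = 2 ^ Fintype.card Λ := by
  simp only [← Finset.prod_pow]
  rw [← Fintype.prod_sum (fun _ x => lowLevel x ^ 2)]
  simp only [sum_lowLevel_sq hM, Finset.prod_const, Finset.card_univ]

theorem prod_mem_mul_prod_notMem (A : Finset Λ) (f : Λ → ℝ) :
    (∏ p : {p : Λ // p ∈ A}, f p) * ∏ p : {p : Λ // p ∉ A}, f p = ∏ p, f p := by
  rw [← Fintype.prod_subtype_mul_prod_subtype (fun p => p ∈ A)]
  congr!

theorem prod_lowLevel_glue (A : Finset Λ) (a : {p : Λ // p ∈ A} → Fin M)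
    (b : {p : Λ // p ∉ A} → Fin M) :
    ∏ p, lowLevel (glue A a b p) = (∏ p, lowLevel (a p)) * ∏ p, lowLevel (b p) := by
  rw [← prod_mem_mul_prod_notMem A]
  congr 1
  · exact Finset.prod_congr rfl fun p _ => by rw [glue_of_mem a b p.2]
  · exact Finset.prod_congr rfl fun p _ => by rw [glue_of_notMem a b p.2]

theorem lowLevel_nonneg (x : Fin M) : 0 ≤ lowLevel x := by unfold lowLevel; split_ifs <;> simp

theorem lowLevel_le_one (x : Fin M) : lowLevel x ≤ 1 := by unfold lowLevel; split_ifs <;> simp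

/-- If `p` is the only neighbour in `A` of a site `q` outside of `A`, then two rows of the
coefficient matrix that differ at `p` are orthogonal: the flip of `q` reverses the sign of each
term. -/
theorem sum_mul_graphState_eq_zero (hM : 2 ≤ M) {A : Finset Λ} {p q : Λ} (hp : p ∈ A)
    (hq : q ∉ A) (hirr : ¬ E q q) (hasymm : ¬ (E p q ∧ E q p))
    (hadj : ∀ p' ∈ A, (E p' q ∨ E q p') ↔ p' = p) {a a' : {p : Λ // p ∈ A} → Fin M}
    (ha : a ⟨p, hp⟩ ≠ a' ⟨p, hp⟩) (hlow : ∀ x, (a x).val < 2) (hlow' : ∀ x, (a' x).val < 2) :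
    ∑ b, graphState E (glue A a b) * graphState E (glue A a' b) = 0 := by
  set f := fun b => graphState E (glue A a b) * graphState E (glue A a' b)
  let e : ({p : Λ // p ∉ A} → Fin M) → ({p : Λ // p ∉ A} → Fin M) :=
    fun b => Function.update b ⟨q, hq⟩ (levelFlip hM (b ⟨q, hq⟩))
  have he : Function.Involutive e := fun b => by
    simp [e, levelFlip]
  have hfe : ∀ b, f (e b) = - f b := fun b => by
    have hb : ∀ a : {p : Λ // p ∈ A} → Fin M,
        graphState E (glue A a (e b)) = graphState E (glue A a b) *
          (signAt (a ⟨p, hp⟩) * ∏ p' : {p : Λ // p ∉ A},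
            ((if E p' q then signAt (b p') else 1) * if E q p' then signAt (b p') else 1)) :=
      fun a => by
      have h1 : b ⟨q, hq⟩ = glue A a b q := (glue_of_notMem a b hq).symm
      rw [show e b = Function.update b ⟨q, hq⟩ (levelFlip hM (glue A a b q)) by rw [← h1],
        glue_update, graphState_update_flip E hM hirr,
        ← prod_mem_mul_prod_notMem A]
      congr 2
      · rw [Fintype.prod_eq_single ⟨p, hp⟩]
        · dsimp only
          rw [glue_of_mem a b hp]
          rcases (hadj p hp).2 rfl with h | h
          · have h2 : ¬ E q p := fun h2 => hasymm ⟨h, h2⟩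
            rw [if_pos h, if_neg h2, mul_one]
          · have h2 : ¬ E p q := fun h2 => hasymm ⟨h2, h⟩
            rw [if_pos h, if_neg h2, one_mul]
        · intro p' hp'
          have h : ¬ (E p' q ∨ E q p') := fun h => hp' (Subtype.ext ((hadj p' p'.2).1 h))
          rw [if_neg (fun h1 => h (Or.inl h1)), if_neg (fun h1 => h (Or.inr h1)), mul_one]
      · refine Finset.prod_congr rfl fun p' _ => ?_
        rw [glue_of_notMem a b p'.2]
    have hsq : (∏ p' : {p : Λ // p ∉ A}, ((if E p' q then signAt (b p') else 1) *
        if E q p' then signAt (b p') else 1)) ^ 2 = 1 := by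
      rw [← Finset.prod_pow]
      refine Finset.prod_eq_one fun p' _ => ?_
      unfold signAt
      split_ifs <;> norm_num
    have hsign : signAt (a ⟨p, hp⟩) * signAt (a' ⟨p, hp⟩) = -1 := by
      have h1 := hlow ⟨p, hp⟩
      have h2 := hlow' ⟨p, hp⟩
      have h3 : (a ⟨p, hp⟩).val ≠ (a' ⟨p, hp⟩).val := fun h => ha (Fin.ext h)
      unfold signAt
      split_ifs <;> first | omega | norm_num
    simp only [f]
    rw [hb a, hb a']
    linear_combination graphState E (glue A a b) * graphState E (glue A a' b) * hsign +
      graphState E (glue A a b) * graphState E (glue A a' b) *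
        (signAt (a ⟨p, hp⟩) * signAt (a' ⟨p, hp⟩)) * hsq
  have h := Equiv.sum_comp (he.toPerm e) f
  have h' : ∑ b, f (he.toPerm e b) = - ∑ b, f b := by
    rw [← Finset.sum_neg_distrib]; exact Finset.sum_congr rfl fun b _ => hfe b
  linarith

/-- The entries of the Gram matrix of the rows, bounded in a form that factorizes over the sites of
`A`: they vanish unless `a'` lies on the two levels and agrees with `a` on `A'`. -/
theorem abs_sum_mul_graphState_le (hM : 2 ≤ M) {A A' : Finset Λ} (π : Λ → Λ)
    (hπ : ∀ p ∈ A', π p ∉ A) (hirr : ∀ p, ¬ E p p) (hasymm : ∀ p q, ¬ (E p q ∧ E q p))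
    (hadj : ∀ p ∈ A', ∀ p' ∈ A, (E p' (π p) ∨ E (π p) p') ↔ p' = p)
    (a a' : {p : Λ // p ∈ A} → Fin M) :
    |∑ b, graphState E (glue A a b) * graphState E (glue A a' b)| ≤
      2 ^ (Fintype.card Λ - A.card) *
        ∏ p, (lowLevel (a' p) ^ 2 * if p.1 ∈ A' ∧ a' p ≠ a p then 0 else 1) := by
  have hRHS : 0 ≤ ∏ p, (lowLevel (a' p) ^ 2 * if p.1 ∈ A' ∧ a' p ≠ a p then (0 : ℝ) else 1) :=
    Finset.prod_nonneg fun p _ => mul_nonneg (sq_nonneg _) (by split_ifs <;> simp)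
  have hval : ∀ (x : Fin M), ¬ x.val < 2 → lowLevel x = 0 := fun x hx => if_neg hx
  have hzero : ∀ a : {p : Λ // p ∈ A} → Fin M, (∃ x, ¬ (a x).val < 2) →
      ∀ b, graphState E (glue A a b) = 0 := by
    rintro a ⟨x, hx⟩ b
    rw [← abs_eq_zero, abs_graphState, prod_lowLevel_glue,
      Finset.prod_eq_zero (Finset.mem_univ x) (hval _ hx), zero_mul]
  by_cases h1 : ∃ x, ¬ (a x).val < 2
  · simp only [hzero a h1, zero_mul, Finset.sum_const_zero, abs_zero]; positivity
  by_cases h2 : ∃ x, ¬ (a' x).val < 2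
  · simp only [hzero a' h2, mul_zero, Finset.sum_const_zero, abs_zero]; positivity
  push Not at h1 h2
  by_cases h3 : ∃ p : {p : Λ // p ∈ A}, p.1 ∈ A' ∧ a' p ≠ a p
  · obtain ⟨p, hp, hne⟩ := h3
    rw [sum_mul_graphState_eq_zero E hM p.2 (hπ p hp) (hirr _) (hasymm _ _) (hadj p hp)
      hne.symm h1 h2, abs_zero]
    positivity
  · push Not at h3
    have hone : ∏ p, (lowLevel (a' p) ^ 2 * if p.1 ∈ A' ∧ a' p ≠ a p then (0 : ℝ) else 1) = 1 := by
      refine Finset.prod_eq_one fun p _ => ?_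
      rw [if_neg (fun h => h.2 (h3 p h.1)), lowLevel, if_pos (h2 p)]; norm_num
    have hlow : ∀ a : {p : Λ // p ∈ A} → Fin M, (∀ x, (a x).val < 2) →
        ∏ p, lowLevel (a p) = 1 := fun a ha => Finset.prod_eq_one fun p _ => if_pos (ha p)
    rw [hone, mul_one]
    calc _ ≤ ∑ b, |graphState E (glue A a b) * graphState E (glue A a' b)| :=
          Finset.abs_sum_le_sum_abs _ _
      _ = ∑ b : {p : Λ // p ∉ A} → Fin M, (∏ p, lowLevel (b p)) ^ 2 := by
          refine Finset.sum_congr rfl fun b _ => ?_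
          rw [abs_mul, abs_graphState, abs_graphState, prod_lowLevel_glue, prod_lowLevel_glue,
            hlow a h1, hlow a' h2, one_mul, sq]
      _ = 2 ^ (Fintype.card Λ - A.card) := by
          rw [sum_prod_lowLevel_sq hM, Fintype.card_subtype_compl, Fintype.card_coe]

/-- Each site of `A' ⊆ A` that is the only neighbour in `A` of some site outside of `A` contributes
`log 2` to the entropy. -/
theorem entanglementEntropy_graphState_ge (hM : 2 ≤ M) {A A' : Finset Λ} (hA' : A' ⊆ A)
    (π : Λ → Λ)
    (hπ : ∀ p ∈ A', π p ∉ A) (hirr : ∀ p, ¬ E p p) (hasymm : ∀ p q, ¬ (E p q ∧ E q p))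
    (hadj : ∀ p ∈ A', ∀ p' ∈ A, (E p' (π p) ∨ E (π p) p') ↔ p' = p) :
    A'.card * Real.log 2 ≤
      entanglementEntropy (fun s : Λ → Fin M => (graphState E s : ℂ)) A := by
  have hZ : ∑ s : Λ → Fin M, ‖(graphState E s : ℂ)‖ ^ 2 = 2 ^ Fintype.card Λ := by
    rw [← sum_prod_lowLevel_sq hM]
    refine Finset.sum_congr rfl fun s _ => ?_
    rw [Complex.norm_real, Real.norm_eq_abs, abs_graphState]
  have hlog : (A'.card : ℝ) * Real.log 2 = -Real.log ((2 ^ A'.card)⁻¹) := by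
    rw [Real.log_inv, Real.log_pow, neg_neg]
  rw [hlog]
  refine neg_log_le_entanglementEntropy (by rw [hZ]; positivity) A fun a => ?_
  have hentry : ∀ a', ‖reducedDensity (fun s : Λ → Fin M => (graphState E s : ℂ)) A a a'‖ ≤
      (2 ^ A.card)⁻¹ *
        ∏ p, (lowLevel (a' p) ^ 2 * if p.1 ∈ A' ∧ a' p ≠ a p then (0 : ℝ) else 1) := fun a' => by
    have h : (coeffMatrix (fun s : Λ → Fin M => (graphState E s : ℂ)) A *
        (coeffMatrix (fun s : Λ → Fin M => (graphState E s : ℂ)) A)ᴴ) a a' =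
        ((∑ b, graphState E (glue A a b) * graphState E (glue A a' b) : ℝ) : ℂ) := by
      simp only [Matrix.mul_apply, Matrix.conjTranspose_apply]
      push_cast
      refine Finset.sum_congr rfl fun b _ => ?_
      exact congrArg₂ (· * ·) rfl (Complex.conj_ofReal _)
    rw [reducedDensity, hZ, Matrix.smul_apply, h, norm_smul, Complex.norm_real, Real.norm_eq_abs,
      Real.norm_eq_abs, abs_of_pos (by positivity)]
    refine (mul_le_mul_of_nonneg_left
      (abs_sum_mul_graphState_le E hM π hπ hirr hasymm hadj a a') (by positivity)).trans_eq ?_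
    rw [← mul_assoc]
    congr 1
    rw [← Nat.sub_add_cancel (Finset.card_le_univ A), pow_add, Nat.add_sub_cancel, mul_inv]
    field_simp
  refine (Finset.sum_le_sum fun a' _ => hentry a').trans ?_
  rw [← Finset.mul_sum,
    ← Fintype.prod_sum (fun (p : {p : Λ // p ∈ A}) (x : Fin M) =>
      lowLevel x ^ 2 * if p.1 ∈ A' ∧ x ≠ a p then (0 : ℝ) else 1)]
  have hfactor : ∀ p : {p : Λ // p ∈ A},
      ∑ x : Fin M, (lowLevel x ^ 2 * if p.1 ∈ A' ∧ x ≠ a p then (0 : ℝ) else 1) ≤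
        if p.1 ∈ A' then 1 else 2 := fun p => by
    by_cases hp : p.1 ∈ A'
    · rw [if_pos hp, Fintype.sum_eq_single (a p) (fun x hx => by simp [hp, hx])]
      simp only [ne_eq, not_true, and_false, if_false, mul_one]
      exact pow_le_one₀ (lowLevel_nonneg _) (lowLevel_le_one _)
    · simp [hp, sum_lowLevel_sq hM]
  have hprod : (∏ p : {p : Λ // p ∈ A}, if p.1 ∈ A' then (1 : ℝ) else 2) * 2 ^ A'.card =
      2 ^ A.card := by
    rw [Finset.prod_coe_sort A (fun p => if p ∈ A' then (1 : ℝ) else 2),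
      ← Finset.prod_const (s := A'), ← Finset.inter_eq_right.2 hA', ← Finset.prod_ite_mem,
      Finset.inter_eq_right.2 hA', ← Finset.prod_mul_distrib, ← Finset.prod_const]
    refine Finset.prod_congr rfl fun p _ => ?_
    split_ifs <;> norm_num
  calc _ ≤ ((2 : ℝ) ^ A.card)⁻¹ * ∏ p : {p : Λ // p ∈ A}, if p.1 ∈ A' then (1 : ℝ) else 2 := by
        refine mul_le_mul_of_nonneg_left (Finset.prod_le_prod (fun p _ => ?_)
          fun p _ => hfactor p) (by positivity)
        exact Finset.sum_nonneg fun x _ => mul_nonneg (sq_nonneg _) (by split_ifs <;> simp)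
    _ = (2 ^ A'.card)⁻¹ := by rw [← hprod]; field_simp

end

/-! ### The state of the shift network -/

theorem state_shiftWeights {M K L H : ℕ} (hK : 0 < K) {d : ℕ} (hd : d ≤ L * (K / 2)) :
    state (shiftWeights M K L d) H =
      fun s : Site H → Fin M => (graphState (shiftEdge H d) s : ℂ) := by
  funext s
  rw [state, output_shiftWeights hK hd, graphState, ← Finset.prod_mul_distrib]
  congr 1
  refine Finset.prod_congr rfl fun p _ => ?_
  by_cases h0 : (s p).val = 0
  · simp [h0, lowLevel, edgeSign]
  · by_cases h1 : (s p).val = 1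
    · simp [h1, lowLevel, edgeSign, signAt]
    · simp [h0, h1, lowLevel]; omega

/-! ### Volume law for the shift graph -/

/-- The sites in the rectangle `[lo, hi) × [b, b')`. -/
def box (H lo hi b b' : ℕ) : Finset (Site H) :=
  (Finset.univ : Finset (Site H)).filter fun p =>
    (lo ≤ p.1.val ∧ p.1.val < hi) ∧ (b ≤ p.2.val ∧ p.2.val < b')

theorem card_box {H lo hi b b' : ℕ} (hhi : hi ≤ H) (hb : b' ≤ H) :
    (box H lo hi b b').card = (hi - lo) * (b' - b) := by
  have h1 : ∀ {lo hi : ℕ}, hi ≤ H →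
      ((Finset.univ : Finset (Fin H)).filter fun x => lo ≤ x.val ∧ x.val < hi).card = hi - lo := by
    intro lo hi h
    rw [← Nat.card_Ico, ← Finset.card_map Fin.valEmbedding]
    congr 1
    ext x
    simp only [Finset.mem_map, Finset.mem_filter, Finset.mem_univ, true_and, Fin.valEmbedding_apply,
      Finset.mem_Ico]
    exact ⟨fun ⟨y, hy, hyx⟩ => hyx ▸ hy, fun hx => ⟨⟨x, by omega⟩, hx, rfl⟩⟩
  rw [← h1 hhi, ← h1 hb, ← Finset.card_product, ← Finset.filter_product, Finset.univ_product_univ]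
  rfl

theorem card_block {H a b α : ℕ} (ha : a + α ≤ H) (hb : b + α ≤ H) :
    (block H a b α).card = α * α := by
  rw [show block H a b α = box H a (a + α) b (b + α) from rfl, card_box ha hb,
    Nat.add_sub_cancel_left, Nat.add_sub_cancel_left]

/-- Partners are taken on the wider of the two sides of the square, at distance `d`. The bounds on `d`
make it comparable to `H`, but small enough for each site to have a partner. -/
theorem volumeLaw_graphState_shiftEdge {M H d : ℕ} (hM : 2 ≤ M) (hd : 1 ≤ d) (hdH : H ≤ 5 * d)
    (hHd : H ≤ 1 ∨ 2 * d ≤ H) :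
    VolumeLaw (Real.log 2 / 6)
      (fun s : Site H → Fin M => (graphState (shiftEdge H d) s : ℂ)) := by
  intro a b α ha hb hcard
  rcases Nat.eq_zero_or_pos α with rfl | hα
  · have h := entanglementEntropy_graphState_ge (shiftEdge H d) hM
      (Finset.empty_subset (block H a b 0)) id (by simp)
      (fun p h => by have := h.1; omega) (fun p q h => by have := h.1.1; have := h.2.1; omega)
      (by simp)
    simpa using h
  have h43 : 4 * α ≤ 3 * H := by
    rw [Finset.card_compl, card_block ha hb, Fintype.card_prod, Fintype.card_fin] at hcard
    have h2 : 2 * (α * α) ≤ H * H := by omega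
    -- `(4 α) ^ 2 ≤ 8 H ^ 2 ≤ (3 H) ^ 2`
    nlinarith
  -- It suffices to find a range `[lo, hi)` of length at least `α / 6` with partners outside.
  have key : ∀ lo hi : ℕ, a ≤ lo → hi ≤ a + α → α ≤ 6 * (hi - lo) → ∀ π : Site H → Site H,
      (∀ p ∈ box H lo hi b (b + α), π p ∉ block H a b α) →
      (∀ p ∈ box H lo hi b (b + α), ∀ p' ∈ block H a b α,
        (shiftEdge H d p' (π p) ∨ shiftEdge H d (π p) p') ↔ p' = p) →
      Real.log 2 / 6 * (α : ℝ) ^ 2 ≤ entanglementEntropy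
        (fun s : Site H → Fin M => (graphState (shiftEdge H d) s : ℂ)) (block H a b α) := by
    intro lo hi hlo hhi hc π hπ hadj
    have hsub : box H lo hi b (b + α) ⊆ block H a b α := fun p hp => by
      simp only [box, block, Finset.mem_filter, Finset.mem_univ, true_and] at hp ⊢
      omega
    refine le_trans ?_ (entanglementEntropy_graphState_ge (shiftEdge H d) hM hsub π hπ
      (fun p h => by have := h.1; omega)
      (fun p q h => by have := h.1.1; have := h.2.1; omega) hadj)
    rw [card_box (hhi.trans ha) hb, Nat.add_sub_cancel_left]
    have h6 : (α : ℝ) ≤ 6 * ((hi - lo : ℕ) : ℝ) := by exact_mod_cast hc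
    have hl := Real.log_pos one_lt_two
    have hα0 : (0 : ℝ) ≤ α := Nat.cast_nonneg _
    push_cast
    have := mul_le_mul_of_nonneg_right h6 (mul_nonneg hα0 hl.le)
    linarith
  by_cases hside : a ≤ H - (a + α)
  · refine key (max a (a + α - d)) (min (a + α) (H - d)) (by omega) (by omega) (by omega)
      (fun p => if h : p.1.val + d < H then (⟨p.1.val + d, h⟩, p.2) else p) ?_ ?_
    · intro p hp
      simp only [box, block, Finset.mem_filter, Finset.mem_univ, true_and] at hp ⊢
      rw [dif_pos (by omega)]
      dsimp only
      omega
    · intro p hp p' hp'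
      simp only [box, block, Finset.mem_filter, Finset.mem_univ, true_and] at hp hp'
      rw [dif_pos (by omega)]
      simp only [shiftEdge, Prod.ext_iff, Fin.ext_iff]
      omega
  · refine key (max a d) (min (a + α) (a + d)) (by omega) (by omega) (by omega)
      (fun p => (⟨p.1.val - d, by omega⟩, p.2)) ?_ ?_
    · intro p hp
      simp only [box, block, Finset.mem_filter, Finset.mem_univ, true_and] at hp ⊢
      omega
    · intro p hp p' hp'
      simp only [box, block, Finset.mem_filter, Finset.mem_univ, true_and] at hp hp'
      simp only [shiftEdge, Prod.ext_iff, Fin.ext_iff]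
      omega

/-! ### Number of parameters -/

theorem numParams_le (M K L r : ℕ) :
    numParams M K L (fun _ => r) ≤ L * (K ^ 2 * (r * (M + r))) + (M + r) := by
  have hw : ∀ l, width M (fun _ => r) l ≤ M + r
    | 0 => Nat.le_add_right _ _
    | _ + 1 => Nat.le_add_left _ _
  refine Nat.add_le_add ?_ (hw L)
  refine (Finset.sum_le_card_nsmul _ _ (K ^ 2 * (r * (M + r))) fun l _ => ?_).trans_eq ?_
  · exact Nat.mul_le_mul_left _ (Nat.mul_le_mul_left _ (hw l))
  · simp

end OverlapCAC

theorem corollary1 (M : ℕ) (hM : 2 ≤ M) :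
    ∃ (r : ℕ) (c : ℝ), 0 < c ∧ ∀ K : ℕ, 2 ≤ K → ∃ C : ℝ,
      ∀ H N : ℕ, 1 ≤ H → N = H * H →
        (∀ L : ℕ, H < L * K →
          ∃ θ : OverlapCAC.Weights M K L (fun _ => r),
            OverlapCAC.VolumeLaw c (OverlapCAC.state θ H)) ∧
        ∃ L : ℕ, H < L * K ∧
          (OverlapCAC.numParams M K L (fun _ => r) : ℝ) ≤ C * Real.sqrt (N : ℝ) := by
  refine ⟨5, Real.log 2 / 6, div_pos (Real.log_pos one_lt_two) (by norm_num), fun K hK =>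
    ⟨((2 * (K ^ 2 * (5 * (M + 5))) + (M + 5) : ℕ) : ℝ), ?_⟩⟩
  rintro H N hH rfl
  refine ⟨fun L hL => ⟨OverlapCAC.shiftWeights M K L (max 1 (H / 3)), ?_⟩, H / K + 1, ?_, ?_⟩
  · have hreach : max 1 (H / 3) ≤ L * (K / 2) := by
      have h1 : L * K ≤ 3 * (L * (K / 2)) := by
        rw [mul_left_comm]; exact Nat.mul_le_mul_left _ (by omega)
      omega
    rw [OverlapCAC.state_shiftWeights (by omega) hreach]
    exact OverlapCAC.volumeLaw_graphState_shiftEdge hM (by omega) (by omega) (by omega)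
  · exact Nat.lt_mul_of_div_lt (Nat.lt_succ_self _) (by omega)
  · rw [Nat.cast_mul, Real.sqrt_mul_self (Nat.cast_nonneg H)]
    -- The depth `H / K + 1` is the least one allowed.
    have hL : H / K + 1 ≤ 2 * H := by have := Nat.div_le_self H K; omega
    have h := OverlapCAC.numParams_le M K (H / K + 1) 5
    have h' : OverlapCAC.numParams M K (H / K + 1) (fun _ => 5) ≤
        (2 * (K ^ 2 * (5 * (M + 5))) + (M + 5)) * H := by
      have h1 := Nat.mul_le_mul_right (K ^ 2 * (5 * (M + 5))) hL
      have h2 := Nat.mul_le_mul_left (M + 5) hH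
      linarith
    exact_mod_cast h'
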